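/- Let $k$ be a commutative ring and let $T$ be a finite lattice with least element $\hat 0$ and greatest element $\hat 1$. Let $\mathrm{End}_{\mathcal L}(T)$ be the monoid, under composition, of all join-endomorphisms of $T$, i.e. maps $T\to T$ preserving all joins, including the empty join $\hat 0$. Let $\mathrm{End}_{k\mathcal L}(T)$ be its monoid algebra over $k$, and let $\mathrm{End}^{\mathrm{tot}}_{k\mathcal L}(T)$ be the two-sided ideal of $\mathrm{End}_{k\mathcal L}(T)$ given by the $k$-linear span of the join-endomorphisms of $T$ whose image is totally ordered. Then the ring $\mathrm{End}^{\mathrm{tot}}_{k\mathcal L}(T)$ has a unique (two-sided) identity element $e_T^{\mathrm{tot}}$; it is a central idempotent of $\mathrm{End}_{k\mathcal L}(T)$, and $$e_T^{\mathrm{tot}} \;=\; -\sum_{B\in\mathcal Z_T}\mu(B,\infty)\,\alpha_B .$$ Here $\mathcal Z_T$ is the set of all chains (totally ordered subsets) of $T$ that contain both $\hat 0$ and $\hat 1$; $\mu$ is the Möbius function of the poset $\mathcal A_T\sqcup\{\infty\}$, where $\mathcal A_T$ is the set of all chains of $T$ containing $\hat 0$, ordered by inclusion, and $\infty$ is an additional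 element larger than every element of $\mathcal A_T$; and, for $B\in\mathcal Z_T$, $\alpha_B\in\mathrm{End}_{\mathcal L}(T)$ is the join-endomorphism $\alpha_B(t)=\min\{b\in B : b\ge t\}$. -/

import Mathlib

namespace TotIdempotent

/-- The monoid of join-endomorphisms of a lattice with `⊥` (maps preserving binary joins and the
empty join `⊥`; on a finite lattice these are the maps preserving all joins), under composition. -/
instance joinEndMonoid (T : Type*) [Lattice T] [BoundedOrder T] : Monoid (SupBotHom T T) where
  mul f g := f.comp g
  one := SupBotHom.id T
  mul_assoc _ _ _ := rfl
  one_mul _ := rfl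
  mul_one _ := rfl

theorem mul_apply {T : Type*} [Lattice T] [BoundedOrder T] (f g : SupBotHom T T) (t : T) :
    (f * g) t = f (g t) := rfl

/-- The `k`-algebra of formal `k`-linear combinations of join-endomorphisms of `T`: it is free over
`k` on the join-endomorphisms, with the bilinear extension of composition as product. -/
abbrev EndAlg (k T : Type*) [CommRing k] [Lattice T] [BoundedOrder T] : Type _ :=
  MonoidAlgebra k (SupBotHom T T)

/-- The join-endomorphisms of `T` with totally ordered image. -/
def totEnd (T : Type*) [Lattice T] [BoundedOrder T] : Set (SupBotHom T T) :=
  {α | IsChain (· ≤ ·) (Set.range α)}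

/-- The `k`-linear span of the join-endomorphisms with totally ordered image. -/
noncomputable def totSpan (k T : Type*) [CommRing k] [Lattice T] [BoundedOrder T] : Submodule k (EndAlg k T) :=
  Submodule.span k ((fun α : SupBotHom T T => MonoidAlgebra.single α (1 : k)) '' totEnd T)

theorem mul_mem_totEnd_left {T : Type*} [Lattice T] [BoundedOrder T] (φ : SupBotHom T T)
    {α : SupBotHom T T} (hα : α ∈ totEnd T) : φ * α ∈ totEnd T := by
  rintro _ ⟨s, rfl⟩ _ ⟨t, rfl⟩ _
  have hmono : Monotone φ := OrderHomClass.mono φ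
  exact (hα.total ⟨s, rfl⟩ ⟨t, rfl⟩).imp (fun h => hmono h) (fun h => hmono h)

theorem mul_mem_totEnd_right {T : Type*} [Lattice T] [BoundedOrder T] (φ : SupBotHom T T)
    {α : SupBotHom T T} (hα : α ∈ totEnd T) : α * φ ∈ totEnd T := by
  rintro _ ⟨s, rfl⟩ _ ⟨t, rfl⟩ _
  exact hα.total ⟨φ s, rfl⟩ ⟨φ t, rfl⟩

theorem mul_mem_totSpan_left {k T : Type*} [CommRing k] [Lattice T] [BoundedOrder T]
    (x : EndAlg k T) {y : EndAlg k T} (hy : y ∈ totSpan k T) : x * y ∈ totSpan k T := by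
  induction hy using Submodule.span_induction with
  | mem y hy =>
    obtain ⟨α, hα, rfl⟩ := hy
    induction x using MonoidAlgebra.induction_linear with
    | zero => simp
    | add f g hf hg => rw [add_mul]; exact add_mem hf hg
    | single φ c =>
      have h : (MonoidAlgebra.single φ c : EndAlg k T) * MonoidAlgebra.single α 1
          = c • MonoidAlgebra.single (φ * α) (1 : k) := by
        simp [MonoidAlgebra.single_mul_single]
      simp only [h]
      exact Submodule.smul_mem _ _
        (Submodule.subset_span ⟨φ * α, mul_mem_totEnd_left φ hα, rfl⟩)
  | zero => simp
  | add y z _ _ hy hz => rw [mul_add]; exact add_mem hy hz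
  | smul c y _ hy => rw [mul_smul_comm]; exact Submodule.smul_mem _ _ hy

theorem mul_mem_totSpan_right {k T : Type*} [CommRing k] [Lattice T] [BoundedOrder T]
    (x : EndAlg k T) {y : EndAlg k T} (hy : y ∈ totSpan k T) : y * x ∈ totSpan k T := by
  induction hy using Submodule.span_induction with
  | mem y hy =>
    obtain ⟨α, hα, rfl⟩ := hy
    induction x using MonoidAlgebra.induction_linear with
    | zero => simp
    | add f g hf hg => rw [mul_add]; exact add_mem hf hg
    | single φ c =>
      have h : (MonoidAlgebra.single α 1 : EndAlg k T) * MonoidAlgebra.single φ c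
          = c • MonoidAlgebra.single (α * φ) (1 : k) := by
        simp [MonoidAlgebra.single_mul_single]
      simp only [h]
      exact Submodule.smul_mem _ _
        (Submodule.subset_span ⟨α * φ, mul_mem_totEnd_right φ hα, rfl⟩)
  | zero => simp
  | add y z _ _ hy hz => rw [add_mul]; exact add_mem hy hz
  | smul c y _ hy => rw [smul_mul_assoc]; exact Submodule.smul_mem _ _ hy

/-- The two-sided ideal of the endomorphism algebra given by the `k`-linear span of the
join-endomorphisms with totally ordered image. -/
noncomputable def totIdeal (k T : Type*) [CommRing k] [Lattice T] [BoundedOrder T] :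
    TwoSidedIdeal (EndAlg k T) :=
  .mk' (totSpan k T : Set (EndAlg k T))
    (zero_mem (totSpan k T))
    (fun hx hy => add_mem (S := Submodule k (EndAlg k T)) hx hy)
    (fun hx => neg_mem (S := Submodule k (EndAlg k T)) hx)
    (fun {x _} hy => mul_mem_totSpan_left x hy)
    (fun {_ y} hx => mul_mem_totSpan_right y hx)

theorem mem_totIdeal {k T : Type*} [CommRing k] [Lattice T] [BoundedOrder T] (x : EndAlg k T) :
    x ∈ totIdeal k T ↔ x ∈ totSpan k T :=
  TwoSidedIdeal.mem_mk' _ _ _ _ _ _ _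

/-- `e` is the identity element of the two-sided ideal `I`. -/
structure IsIdentityOf {R : Type*} [Ring R] (I : TwoSidedIdeal R) (e : R) : Prop where
  mem : e ∈ I
  mul_left : ∀ x ∈ I, e * x = x
  mul_right : ∀ x ∈ I, x * e = x

/-- The poset, under inclusion, of the chains of `T` with least element `⊥`. -/
abbrev BotChain (T : Type*) [Lattice T] [BoundedOrder T] : Type _ :=
  {A : Finset T // IsChain (· ≤ ·) (A : Set T) ∧ ⊥ ∈ A}

/-- The chains of `T` with least element `⊥` and greatest element `⊤`. -/
abbrev FullChain (T : Type*) [Lattice T] [BoundedOrder T] : Type _ :=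
  {B : BotChain T // ⊤ ∈ B.1}

noncomputable instance fullChainFintype (T : Type*) [Lattice T] [BoundedOrder T] [Finite T] :
    Fintype (FullChain T) :=
  Fintype.ofFinite _

open scoped Classical in
/-- The intervals of the poset of chains with a new greatest element `∞` adjoined. -/
noncomputable instance chainTopLocallyFiniteOrder (T : Type*) [Lattice T] [BoundedOrder T]
    [Finite T] : LocallyFiniteOrder (WithTop (BotChain T)) :=
  letI : Fintype (WithTop (BotChain T)) :=
    letI : Finite (WithTop (BotChain T)) := inferInstanceAs (Finite (Option (BotChain T)))
    Fintype.ofFinite _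
  Fintype.toLocallyFiniteOrder

open scoped Classical in
/-- The value `μ(B, ∞)` of the Möbius function of the poset of chains with a new greatest
element `∞` adjoined. -/
noncomputable def chainMu {T : Type*} [Lattice T] [BoundedOrder T] [Finite T] (B : BotChain T) :
    ℤ :=
  IncidenceAlgebra.mu ℤ (B : WithTop (BotChain T)) ⊤

open scoped Classical in
/-- The least element of `B` above `t`; see `isLeast_alphaFun`. -/
noncomputable def alphaFun {T : Type*} [Lattice T] [BoundedOrder T] (B : FullChain T) (t : T) : T :=
  (B.1.1.filter (fun b => t ≤ b)).inf id

theorem isLeast_alphaFun {T : Type*} [Lattice T] [BoundedOrder T] (B : FullChain T) (t : T) :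
    IsLeast {b | b ∈ B.1.1 ∧ t ≤ b} (alphaFun B t) := by
  classical
  have hne : (B.1.1.filter (fun b => t ≤ b)).Nonempty :=
    ⟨⊤, Finset.mem_filter.2 ⟨B.2, le_top⟩⟩
  refine ⟨?_, fun b hb => ?_⟩
  · have key : (B.1.1.filter (fun b => t ≤ b)).inf id ∈ {b | b ∈ B.1.1 ∧ t ≤ b} := by
      rw [← Finset.inf'_eq_inf hne]
      refine Finset.inf'_mem _ ?_ _ hne _ fun b hb => Finset.mem_filter.1 hb
      rintro x ⟨hx, htx⟩ y ⟨hy, hty⟩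
      rcases B.1.2.1.total hx hy with h | h
      · rw [inf_eq_left.2 h]; exact ⟨hx, htx⟩
      · rw [inf_eq_right.2 h]; exact ⟨hy, hty⟩
    unfold alphaFun
    convert key
  · unfold alphaFun
    exact Finset.inf_le (f := id) (Finset.mem_filter.2 hb)

/-- The join-endomorphism `α_B : t ↦ min {b ∈ B | b ≥ t}`. -/
noncomputable def alpha {T : Type*} [Lattice T] [BoundedOrder T] (B : FullChain T) :
    SupBotHom T T where
  toFun := alphaFun B
  map_sup' s t := by
    have hs := isLeast_alphaFun B s
    have ht := isLeast_alphaFun B t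
    have hst := isLeast_alphaFun B (s ⊔ t)
    apply le_antisymm
    · apply hst.2
      refine ⟨?_, sup_le_sup hs.1.2 ht.1.2⟩
      rcases B.1.2.1.total hs.1.1 ht.1.1 with h | h
      · rw [sup_eq_right.2 h]; exact ht.1.1
      · rw [sup_eq_left.2 h]; exact hs.1.1
    · exact sup_le (hs.2 ⟨hst.1.1, le_sup_left.trans hst.1.2⟩)
        (ht.2 ⟨hst.1.1, le_sup_right.trans hst.1.2⟩)
  map_bot' := le_bot_iff.1 ((isLeast_alphaFun B ⊥).2 ⟨B.1.2.2, le_rfl⟩)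

end TotIdempotent

/-!
Write `w C = -μ(C, ∞)` for a chain `C` containing `⊥`, and `w C = 0` for every other subset of `T`.
The recursion for the Möbius function says that the sum of `w C` over all `C ⊇ B` is `1` if `B` is
a chain and `0` otherwise (`isChainWeight_chainWeight`), a condition that is invariant under
reversing the order (`IsChainWeight.dual`).

By inclusion-exclusion, the sum of `w C` over the `C` that contain `B` and avoid `F` vanishes as
soon as some element of `F` is comparable with all elements of `B ∪ F`
(`IsChainWeight.sum_avoiding_eq_zero`). In particular `w` vanishes on chains without `⊤`, so the
candidate identity is `e = ∑ w(B) α_B` over the chains `B` from `⊥` to `⊤`.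

For a map `p` with totally ordered image, the condition that rounding `p` up to `C` gives a
prescribed map `q` has the form "`C` contains the image of `q` and avoids a set `F`". If `q ≠ p`, a
minimal value `p y ≠ q y` belongs to `F` and is comparable with everything in sight, so the sum of
`w` over these `C` is `1` for `q = p` and `0` otherwise (`IsChainWeight.sum_isLeast`). For `p = α`
this gives `e * α = α`, because `α_B * α` rounds `α` up to `B`. For the equation `α * e = α` the
same statement is applied in the dual order to the right adjoint of `α`, which the right adjoint
of `α * α_B` rounds down to `B`.
-/

namespace TotIdempotent

open Finset
open scoped Classical

/-! ### Weights summing to one above every chain -/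

/-- A weight on the subsets of `P` whose total over the supersets of `B` is `1` if `B` is a chain
and `0` otherwise. -/
def IsChainWeight {P : Type*} [PartialOrder P] [Fintype P] (w : Finset P → ℤ) : Prop :=
  ∀ B : Finset P, ∑ C with B ⊆ C, w C = if IsChain (· ≤ ·) (B : Set P) then 1 else 0

section Weight

variable {P : Type*} [PartialOrder P] [Fintype P] {w : Finset P → ℤ}

theorem IsChainWeight.dual (hw : IsChainWeight w) :
    IsChainWeight (P := Pᵒᵈ) (fun C => w (C.map OrderDual.ofDual.toEmbedding)) := by
  intro B
  have h := hw (B.map OrderDual.ofDual.toEmbedding)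
  have hc : IsChain (· ≤ ·) (B : Set Pᵒᵈ) ↔
      IsChain (· ≤ ·) ((B.map OrderDual.ofDual.toEmbedding : Finset P) : Set P) := by
    constructor
    · intro H x hx y hy hxy
      exact (H (x := OrderDual.toDual x) (by simpa using hx) (y := OrderDual.toDual y)
        (by simpa using hy) (by simpa using hxy)).symm
    · intro H x hx y hy hxy
      exact (H (x := OrderDual.ofDual x) (by simpa using hx) (y := OrderDual.ofDual y)
        (by simpa using hy) (by simpa using hxy)).symm
  simp only [hc]
  rw [← h]
  refine sum_nbij' (fun C => C.map OrderDual.ofDual.toEmbedding)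
    (fun C => C.map OrderDual.toDual.toEmbedding) ?_ ?_ ?_ ?_ ?_
  · intro C hC
    simpa using hC
  · intro C hC
    simp only [mem_filter, mem_univ, true_and] at hC ⊢
    intro x hx
    simpa using hC (mem_map_of_mem _ hx)
  · intro C _
    ext x
    simp
  · intro C _
    ext x
    simp
  · intro C _
    rfl

/-- The toggling principle: an element of `F` that is comparable with all elements of `B ∪ F`
cancels the total weight of the sets that contain `B` and avoid `F`. -/
theorem IsChainWeight.sum_avoiding_eq_zero (hw : IsChainWeight w) {a : P} {B F : Finset P}
    (haF : a ∈ F) (hB : ∀ x ∈ B, x ≤ a ∨ a ≤ x) (hF : ∀ x ∈ F, x ≤ a ∨ a ≤ x) :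
    ∑ C with B ⊆ C ∧ Disjoint C F, w C = 0 := by
  -- One forbidden element is imposed at a time; `a` is the first.
  have split : ∀ (x : P) (B F : Finset P),
      ∑ C with B ⊆ C ∧ Disjoint C (insert x F), w C
        = ∑ C with B ⊆ C ∧ Disjoint C F, w C
          - ∑ C with insert x B ⊆ C ∧ Disjoint C F, w C := by
    intro x B F
    rw [eq_sub_iff_add_eq, ← sum_filter_add_sum_filter_not
      (univ.filter fun C : Finset P => B ⊆ C ∧ Disjoint C F) (fun C => x ∉ C)]
    simp only [filter_filter]
    congr 1 <;> refine sum_congr (filter_congr fun C _ => ?_) fun _ _ => rfl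
    · rw [disjoint_insert_right]; tauto
    · rw [insert_subset_iff]; tauto
  suffices H : ∀ (F : Finset P), (∀ x ∈ F, x ≤ a ∨ a ≤ x) → ∀ B : Finset P,
      (∀ x ∈ B, x ≤ a ∨ a ≤ x) → ∑ C with B ⊆ C ∧ Disjoint C (insert a F), w C = 0 by
    have := H F hF B hB
    rwa [insert_eq_of_mem haF] at this
  intro F
  induction F using Finset.induction_on with
  | empty =>
    intro _ B hB
    rw [split]
    simp only [disjoint_empty_right, and_true]
    rw [hw, hw, sub_eq_zero]
    congr 1
    rw [coe_insert, eq_iff_iff]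
    refine ⟨fun h => h.insert fun x hx _ => (hB x hx).symm, fun h => h.mono (Set.subset_insert _ _)⟩
  | insert x F _ ih =>
    intro hF B hB
    have hF' : ∀ y ∈ F, y ≤ a ∨ a ≤ y := fun y hy => hF y (mem_insert_of_mem hy)
    rw [insert_comm, split, ih hF' B hB, ih hF' (insert x B), sub_zero]
    intro y hy
    rcases mem_insert.1 hy with rfl | hy
    · exact hF y (mem_insert_self _ _)
    · exact hB y hy

theorem IsChainWeight.eq_zero_of_notMem (hw : IsChainWeight w) {a : P}
    (ha : ∀ x, x ≤ a ∨ a ≤ x) {C : Finset P} (hC : a ∉ C) : w C = 0 := by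
  rw [← hw.sum_avoiding_eq_zero (B := C) (F := Cᶜ) (mem_compl.2 hC) (fun x _ => ha x)
    (fun x _ => ha x)]
  have : (univ.filter fun D : Finset P => C ⊆ D ∧ Disjoint D Cᶜ) = {C} := by
    ext D
    simp only [mem_filter, mem_univ, true_and, mem_singleton, disjoint_compl_right_iff]
    exact ⟨fun h => h.2.antisymm h.1, fun h => h ▸ ⟨Subset.rfl, Subset.rfl⟩⟩
  rw [this, sum_singleton]

/-- The sets `C` for which `q` is the result of rounding `p` up to `C` have total weight `1` if
`q = p` and `0` otherwise. -/
theorem IsChainWeight.sum_isLeast (hw : IsChainWeight w) {Y : Type*} [Fintype Y] {p : Y → P}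
    (hp : IsChain (· ≤ ·) (Set.range p)) (q : Y → P) :
    ∑ C : Finset P with ∀ y, IsLeast {c | c ∈ C ∧ p y ≤ c} (q y), w C
      = if q = p then 1 else 0 := by
  split_ifs with hqp
  · subst hqp
    have h := hw (univ.image q)
    rw [if_pos (by simpa using hp)] at h
    rw [← h]
    refine sum_congr (filter_congr fun C _ => ?_) fun _ _ => rfl
    rw [image_subset_iff]
    exact ⟨fun h y _ => (h y).1.1, fun h y => ⟨⟨h y (mem_univ y), le_rfl⟩, fun c hc => hc.2⟩⟩
  · by_cases hex : ∃ C₀ : Finset P, ∀ y, IsLeast {c | c ∈ C₀ ∧ p y ≤ c} (q y)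
    · obtain ⟨C₀, hC₀⟩ := hex
      have hpq : ∀ y, p y ≤ q y := fun y => (hC₀ y).1.2
      obtain ⟨y₁, hy₁⟩ := Function.ne_iff.1 hqp
      -- The least value of `p` that `q` moves serves as the toggled element.
      obtain ⟨_, ⟨y₀, hy₀, rfl⟩, hmin⟩ := (Set.toFinite (p '' {y | q y ≠ p y})).exists_minimal
        ⟨_, y₁, hy₁, rfl⟩
      have hle : ∀ y, q y ≠ p y → p y₀ ≤ p y := fun y hy =>
        (hp.total ⟨y₀, rfl⟩ ⟨y, rfl⟩).elim id fun h => hmin ⟨y, hy, rfl⟩ h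
      rw [← hw.sum_avoiding_eq_zero (a := p y₀) (B := univ.image q)
        (F := univ.filter fun c => ∃ y, p y ≤ c ∧ ¬ q y ≤ c)]
      · refine sum_congr (filter_congr fun C _ => ?_) fun _ _ => rfl
        rw [image_subset_iff, disjoint_left]
        constructor
        · refine fun h => ⟨fun y _ => (h y).1.1, fun c hc hcF => ?_⟩
          obtain ⟨y, hy, hy'⟩ := (mem_filter.1 hcF).2
          exact hy' ((h y).2 ⟨hc, hy⟩)
        · refine fun h y => ⟨⟨h.1 y (mem_univ y), hpq y⟩, fun c hc => ?_⟩
          by_contra hcon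
          exact h.2 hc.1 (mem_filter.2 ⟨mem_univ c, y, hc.2, hcon⟩)
      · exact mem_filter.2 ⟨mem_univ _, y₀, le_rfl, fun h => hy₀ (h.antisymm (hpq y₀))⟩
      · intro x hx
        obtain ⟨y, -, rfl⟩ := mem_image.1 hx
        by_cases hy : q y = p y
        · rw [hy]
          exact hp.total ⟨y, rfl⟩ ⟨y₀, rfl⟩
        · exact Or.inr ((hle y hy).trans (hpq y))
      · intro x hx
        obtain ⟨y, hy, hy'⟩ := (mem_filter.1 hx).2
        exact Or.inr ((hle y fun h => hy' (h ▸ hy)).trans hy)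
    · rw [filter_false_of_mem fun C _ h => hex ⟨C, h⟩, sum_empty]

end Weight

/-! ### The weight given by the Möbius function -/

section Moebius

variable {T : Type*} [Lattice T] [BoundedOrder T] [Fintype T]

/-- The coefficient `-μ(C, ∞)` for a chain `C` containing `⊥`, extended by `0` to all other subsets
of `T`. -/
noncomputable def chainWeight (C : Finset T) : ℤ :=
  if h : IsChain (· ≤ ·) (C : Set T) ∧ ⊥ ∈ C then -chainMu ⟨C, h⟩ else 0

/-- The total weight above a chain is the sum of `-μ(C, ∞)` over `B ≤ C < ∞`, which is
`μ(∞, ∞) = 1`. -/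
theorem sum_chainWeight_of_isChain {B : Finset T}
    (hB : IsChain (· ≤ ·) (B : Set T) ∧ ⊥ ∈ B) : ∑ C with B ⊆ C, chainWeight C = 1 := by
  have h0 := IncidenceAlgebra.sum_Icc_mu_left (𝕜 := ℤ)
    ((⟨B, hB⟩ : BotChain T) : WithTop (BotChain T)) ⊤
  rw [if_neg WithTop.coe_ne_top] at h0
  rw [← insert_erase (show (⊤ : WithTop (BotChain T)) ∈ Icc _ _ from mem_Icc.2 ⟨le_top, le_rfl⟩),
    sum_insert (notMem_erase _ _), IncidenceAlgebra.mu_self] at h0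
  have h1 : ∑ C : BotChain T with B ⊆ C.1, chainMu C
      = ∑ x ∈ (Icc ((⟨B, hB⟩ : BotChain T) : WithTop (BotChain T)) ⊤).erase ⊤,
          IncidenceAlgebra.mu ℤ x ⊤ := by
    refine sum_nbij (fun C => (C : WithTop (BotChain T))) ?_ ?_ ?_ ?_
    · intro C hC
      refine mem_erase.2 ⟨WithTop.coe_ne_top, mem_Icc.2 ⟨WithTop.coe_le_coe.2 ?_, le_top⟩⟩
      exact (mem_filter.1 hC).2
    · exact WithTop.coe_injective.injOn
    · intro x hx
      obtain ⟨hx, hx'⟩ := mem_erase.1 hx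
      lift x to BotChain T using hx
      have hBx : (⟨B, hB⟩ : BotChain T) ≤ x := WithTop.coe_le_coe.1 (mem_Icc.1 hx').1
      exact ⟨x, mem_coe.2 (mem_filter.2 ⟨mem_univ x, hBx⟩), rfl⟩
    · intro C _
      rfl
  have h2 : ∑ C : BotChain T with B ⊆ C.1, -chainMu C = ∑ C with B ⊆ C, chainWeight C := by
    refine sum_of_injOn (fun C : BotChain T => C.1) Subtype.val_injective.injOn ?_ ?_ ?_
    · intro C hC
      simpa using hC
    · intro C hC hC'
      refine dif_neg fun hch => hC' ⟨⟨C, hch⟩, by simpa using hC, rfl⟩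
    · intro C _
      rw [chainWeight, dif_pos C.2]
  rw [← h2, sum_neg_distrib, h1]
  linarith

theorem isChainWeight_chainWeight : IsChainWeight (P := T) chainWeight := by
  intro B
  split_ifs with hB
  · have hB' : IsChain (· ≤ ·) ((insert ⊥ B : Finset T) : Set T) := by
      rw [coe_insert]
      exact hB.insert fun _ _ _ => Or.inl bot_le
    rw [← sum_chainWeight_of_isChain ⟨hB', mem_insert_self _ _⟩]
    symm
    refine sum_subset (fun C hC => ?_) fun C hC hC' => dif_neg fun h => hC' ?_
    · simp only [mem_filter, mem_univ, true_and] at hC ⊢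
      exact (subset_insert _ _).trans hC
    · simp only [mem_filter, mem_univ, true_and] at hC ⊢
      exact insert_subset h.2 hC
  · refine sum_eq_zero fun C hC => dif_neg fun h => hB (h.1.mono ?_)
    exact_mod_cast (mem_filter.1 hC).2

/-- Sums over the chains from `⊥` to `⊤`, weighted by `-μ(·, ∞)`, are sums over all subsets. -/
theorem sum_fullChain_filter (R : FullChain T → Prop) (S : Finset T → Prop)
    [DecidablePred R] [DecidablePred S] (hRS : ∀ B, R B ↔ S B.1.1) :
    ∑ B with R B, -chainMu B.1 = ∑ C with S C, chainWeight C := by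
  refine sum_of_injOn (fun B : FullChain T => B.1.1)
    (Subtype.val_injective.comp Subtype.val_injective).injOn ?_ ?_ ?_
  · intro B hB
    simpa [hRS] using hB
  · intro C hC hC'
    by_contra hne
    have hch : IsChain (· ≤ ·) (C : Set T) ∧ ⊥ ∈ C := by
      by_contra h
      exact hne (dif_neg h)
    have htop : ⊤ ∈ C := by
      by_contra h
      exact hne (isChainWeight_chainWeight.eq_zero_of_notMem (fun _ => Or.inl le_top) h)
    exact hC' ⟨⟨⟨C, hch⟩, htop⟩, by simpa [hRS] using hC, rfl⟩
  · intro B _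
    rw [chainWeight, dif_pos B.1.2]

end Moebius

/-! ### Composition with the endomorphisms `α_B` -/

theorem alpha_mul_eq_iff {T : Type*} [Lattice T] [BoundedOrder T] (B : FullChain T)
    (f g : SupBotHom T T) :
    alpha B * f = g ↔ ∀ t, IsLeast {c | c ∈ B.1.1 ∧ f t ≤ c} (g t) := by
  constructor
  · rintro rfl t
    exact isLeast_alphaFun B (f t)
  · intro h
    exact DFunLike.ext _ _ fun t => (isLeast_alphaFun B (f t)).unique (h t)

section Adjoint

variable {T : Type*} [Lattice T] [BoundedOrder T] [Fintype T]

/-- The right adjoint of a join-endomorphism: the greatest element that it maps below `y`. -/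
noncomputable def rightAdj (f : SupBotHom T T) (y : T) : T :=
  (univ.filter fun t => f t ≤ y).sup id

theorem gc_rightAdj (f : SupBotHom T T) : GaloisConnection f (rightAdj f) := by
  intro t y
  constructor
  · intro h
    exact le_sup (f := id) (mem_filter.2 ⟨mem_univ t, h⟩)
  · intro h
    refine (OrderHomClass.mono f h).trans ?_
    rw [rightAdj, map_finset_sup]
    exact Finset.sup_le fun s hs => (mem_filter.1 hs).2

theorem rightAdj_injective : Function.Injective (rightAdj : SupBotHom T T → T → T) := by
  intro f g h
  refine DFunLike.ext _ _ fun t => eq_of_forall_ge_iff fun y => ?_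
  rw [gc_rightAdj f t y, gc_rightAdj g t y, h]

theorem isChain_range_rightAdj {f : SupBotHom T T} (hf : f ∈ totEnd T) :
    IsChain (· ≤ ·) (Set.range (rightAdj f)) := by
  rintro _ ⟨y, rfl⟩ _ ⟨z, rfl⟩ _
  refine (hf.total ⟨rightAdj f y, rfl⟩ ⟨rightAdj f z, rfl⟩).imp (fun h => ?_) fun h => ?_
  · exact (gc_rightAdj f _ _).1 (h.trans ((gc_rightAdj f).l_u_le z))
  · exact (gc_rightAdj f _ _).1 (h.trans ((gc_rightAdj f).l_u_le y))

/-- The right adjoint of `f * alpha B` is the right adjoint of `f` rounded down to `B`. -/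
theorem mul_alpha_eq_iff (B : FullChain T) (f g : SupBotHom T T) :
    f * alpha B = g ↔
      ∀ y, IsGreatest {c | c ∈ B.1.1 ∧ c ≤ rightAdj f y} (rightAdj g y) := by
  have hα : ∀ t b, alpha B t ≤ b ↔ ∃ c ∈ B.1.1, t ≤ c ∧ c ≤ b := fun t b =>
    ⟨fun h => ⟨alphaFun B t, (isLeast_alphaFun B t).1.1, (isLeast_alphaFun B t).1.2, h⟩,
      fun ⟨c, hc, htc, hcb⟩ => ((isLeast_alphaFun B t).2 ⟨hc, htc⟩).trans hcb⟩
  have hmul : ∀ t y, (f * alpha B) t ≤ y ↔ ∃ c ∈ B.1.1, t ≤ c ∧ c ≤ rightAdj f y := fun t y => by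
    rw [mul_apply, gc_rightAdj f, hα]
  constructor
  · rintro rfl y
    have hub : ∀ c ∈ B.1.1, c ≤ rightAdj f y → c ≤ rightAdj (f * alpha B) y := fun c hc hcy =>
      (gc_rightAdj _ _ _).1 ((hmul _ _).2 ⟨c, hc, le_rfl, hcy⟩)
    obtain ⟨c, hc, hle, hcy⟩ := (hmul _ _).1 ((gc_rightAdj (f * alpha B)).l_u_le y)
    have hceq := (hub c hc hcy).antisymm hle
    exact ⟨⟨hceq ▸ hc, hceq ▸ hcy⟩, fun d hd => hub d hd.1 hd.2⟩
  · intro h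
    refine DFunLike.ext _ _ fun t => eq_of_forall_ge_iff fun y => ?_
    rw [hmul, gc_rightAdj g]
    exact ⟨fun ⟨c, hc, htc, hcy⟩ => htc.trans ((h y).2 ⟨hc, hcy⟩),
      fun ht => ⟨_, (h y).1.1, ht, (h y).1.2⟩⟩

theorem sum_alpha_mul_eq {f : SupBotHom T T} (hf : f ∈ totEnd T) (g : SupBotHom T T) :
    ∑ B : FullChain T with alpha B * f = g, -chainMu B.1 = if g = f then 1 else 0 := by
  rw [sum_fullChain_filter _ (fun C => ∀ t, IsLeast {c | c ∈ C ∧ f t ≤ c} (g t))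
    fun B => alpha_mul_eq_iff B f g]
  simpa [DFunLike.coe_fn_eq] using isChainWeight_chainWeight.sum_isLeast hf g

theorem sum_mul_alpha_eq {f : SupBotHom T T} (hf : f ∈ totEnd T) (g : SupBotHom T T) :
    ∑ B : FullChain T with f * alpha B = g, -chainMu B.1 = if g = f then 1 else 0 := by
  rw [sum_fullChain_filter _ (fun C => ∀ y, IsGreatest {c | c ∈ C ∧ c ≤ rightAdj f y}
    (rightAdj g y)) fun B => mul_alpha_eq_iff B f g]
  have hchain : IsChain (α := Tᵒᵈ) (· ≤ ·) (Set.range fun y => OrderDual.toDual (rightAdj f y)) :=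
    (isChain_range_rightAdj hf).symm
  have h := isChainWeight_chainWeight.dual.sum_isLeast hchain
    fun y => OrderDual.toDual (rightAdj g y)
  have hiff : ((fun y => OrderDual.toDual (rightAdj g y)) =
      fun y => OrderDual.toDual (rightAdj f y)) ↔ g = f :=
    ⟨fun h => rightAdj_injective h, fun h => h ▸ rfl⟩
  simp only [hiff] at h
  rw [← h]
  refine sum_nbij' (fun C => C.map OrderDual.toDual.toEmbedding)
    (fun C => C.map OrderDual.ofDual.toEmbedding) ?_ ?_ ?_ ?_ ?_
  · intro C hC
    simp only [mem_filter, mem_univ, true_and] at hC ⊢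
    intro y
    exact ⟨by simpa using (hC y).1, fun c hc =>
      (hC y).2 (show OrderDual.ofDual c ∈ _ from ⟨by simpa using hc.1, hc.2⟩)⟩
  · intro C hC
    simp only [mem_filter, mem_univ, true_and] at hC ⊢
    intro y
    exact ⟨by simpa using (hC y).1, fun c hc =>
      (hC y).2 (show OrderDual.toDual c ∈ _ from ⟨by simpa using hc.1, hc.2⟩)⟩
  · intro C _
    ext x
    simp
  · intro C _
    ext x
    simp
  · intro C _
    congr 1
    ext x
    simp

end Adjoint

/-! ### The identity element -/

section Identity

variable (k : Type*) [CommRing k] (T : Type*) [Lattice T] [BoundedOrder T]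

/-- The element `-∑ μ(B, ∞) α_B`, summed over the chains `B` from `⊥` to `⊤`. -/
noncomputable def totIdempotent [Finite T] : EndAlg k T :=
  - ∑ B : FullChain T, (chainMu B.1 : k) • (MonoidAlgebra.single (alpha B) 1 : EndAlg k T)

variable {k T}

theorem sum_smul_single_eq_single {ι M : Type*} [Fintype ι] [DecidableEq M] (c : ι → ℤ)
    (m : ι → M) (a : M)
    (h : ∀ g, ∑ i with m i = g, c i = if g = a then 1 else 0) :
    ∑ i, (c i : k) • (MonoidAlgebra.single (m i) 1 : MonoidAlgebra k M)
      = MonoidAlgebra.single a 1 := by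
  -- `M` may be infinite, so the sum is fibred over a finite set containing `a` and all `m i`.
  have key : ∀ s : Finset M, (∀ i, m i ∈ s) → a ∈ s →
      ∑ i, (c i : k) • (MonoidAlgebra.single (m i) 1 : MonoidAlgebra k M)
        = MonoidAlgebra.single a 1 := by
    intro s hs ha
    rw [← sum_fiberwise_of_maps_to (g := m) (t := s) fun i _ => hs i]
    have : ∀ g ∈ s, ∑ i with m i = g, (c i : k) • (MonoidAlgebra.single (m i) 1 :
        MonoidAlgebra k M) = if g = a then MonoidAlgebra.single a 1 else 0 := by
      intro g _
      have hg : ∑ i with m i = g, (c i : k) • (MonoidAlgebra.single (m i) 1 : MonoidAlgebra k M)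
          = ∑ i with m i = g, (c i : k) • (MonoidAlgebra.single g 1 : MonoidAlgebra k M) :=
        sum_congr rfl fun i hi => by rw [(mem_filter.1 hi).2]
      rw [hg, ← sum_smul, ← Int.cast_sum, h]
      split_ifs with hga
      · rw [hga, Int.cast_one, one_smul]
      · rw [Int.cast_zero, zero_smul]
    rw [sum_congr rfl this, sum_ite_eq' s a, if_pos ha]
  exact key (insert a (univ.image m)) (fun i => mem_insert_of_mem (mem_image_of_mem _ (mem_univ i)))
    (mem_insert_self _ _)

theorem alpha_mem_totEnd (B : FullChain T) : alpha B ∈ totEnd T := by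
  refine B.1.2.1.mono ?_
  rintro _ ⟨t, rfl⟩
  exact (isLeast_alphaFun B t).1.1

theorem isIdentityOf_totIdempotent [Finite T] :
    IsIdentityOf (totIdeal k T) (totIdempotent k T) := by
  have := Fintype.ofFinite T
  have heq : totIdempotent k T = ∑ B : FullChain T, ((-chainMu B.1 : ℤ) : k) •
      (MonoidAlgebra.single (alpha B) 1 : EndAlg k T) := by
    simp [totIdempotent, sum_neg_distrib]
  refine ⟨?_, ?_, ?_⟩
  · rw [mem_totIdeal]
    exact neg_mem (sum_mem fun B _ => Submodule.smul_mem _ _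
      (Submodule.subset_span ⟨alpha B, alpha_mem_totEnd B, rfl⟩))
  · intro x hx
    rw [mem_totIdeal] at hx
    induction hx using Submodule.span_induction with
    | mem x hx =>
      obtain ⟨f, hf, rfl⟩ := hx
      simp only [heq, sum_mul, smul_mul_assoc, MonoidAlgebra.single_mul_single, mul_one]
      exact sum_smul_single_eq_single _ _ _ (sum_alpha_mul_eq hf)
    | zero => exact mul_zero _
    | add x y _ _ hx hy => rw [mul_add, hx, hy]
    | smul c x _ hx => rw [mul_smul_comm, hx]
  · intro x hx
    rw [mem_totIdeal] at hx
    induction hx using Submodule.span_induction with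
    | mem x hx =>
      obtain ⟨f, hf, rfl⟩ := hx
      simp only [heq, mul_sum, mul_smul_comm, MonoidAlgebra.single_mul_single, mul_one]
      exact sum_smul_single_eq_single _ _ _ (sum_mul_alpha_eq hf)
    | zero => exact zero_mul _
    | add x y _ _ hx hy => rw [add_mul, hx, hy]
    | smul c x _ hx => rw [smul_mul_assoc, hx]

theorem IsIdentityOf.unique {R : Type*} [Ring R] {I : TwoSidedIdeal R} {e f : R}
    (he : IsIdentityOf I e) (hf : IsIdentityOf I f) : e = f :=
  (hf.mul_right e he.mem).symm.trans (he.mul_left f hf.mem)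

/-- Both `e * x` and `x * e` lie in the ideal, hence both are equal to `e * x * e`. -/
theorem IsIdentityOf.commute {R : Type*} [Ring R] {I : TwoSidedIdeal R} {e : R}
    (he : IsIdentityOf I e) (x : R) : x * e = e * x := by
  rw [← he.mul_left _ (I.mul_mem_left x e he.mem), ← mul_assoc,
    he.mul_right _ (I.mul_mem_right e x he.mem)]

end Identity

end TotIdempotent

theorem mainTheorem1 (k : Type*) [CommRing k] (T : Type*) [Lattice T] [BoundedOrder T] [Finite T] :
    (∃! e : TotIdempotent.EndAlg k T,
      TotIdempotent.IsIdentityOf (TotIdempotent.totIdeal k T) e) ∧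
    ∀ e : TotIdempotent.EndAlg k T,
      TotIdempotent.IsIdentityOf (TotIdempotent.totIdeal k T) e →
        IsIdempotentElem e ∧ e ∈ Subalgebra.center k (TotIdempotent.EndAlg k T) ∧
        e = - ∑ B : TotIdempotent.FullChain T,
              (TotIdempotent.chainMu B.1 : k) •
                (MonoidAlgebra.single (TotIdempotent.alpha B) 1 : TotIdempotent.EndAlg k T) := by
  have h := TotIdempotent.isIdentityOf_totIdempotent (k := k) (T := T)
  exact ⟨⟨_, h, fun e he => he.unique h⟩, fun e he =>
    ⟨he.mul_left e he.mem, Subalgebra.mem_center_iff.2 he.commute, he.unique h⟩⟩
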